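/- Let $M \ge 1$ be an integer and let $N \ge 2$ be an even integer, with $(M,N) \neq (1,2)$. Let $V^2_M \subset \mathbb{C}^{M\times M}$ be the affine variety of complex symmetric $M \times M$ matrices of rank at most $2$, and let $$\mathcal{B}_{M,N} \subseteq \mathbb{P}\big((\mathbb{C}^M)^N\big) \times \mathbb{P}(V^2_M)$$ be the incidence variety of all pairs $([\alpha_0, \ldots, \alpha_{N-1}], [A])$ that satisfy the equations $$\alpha_0^T A\, \alpha_0 = 0, \qquad \alpha_{N/2}^T A\, \alpha_{N/2} = 0, \qquad \alpha_k^T A\, \alpha_k + \alpha_{N-k}^T A\, \alpha_{N-k} = 0 \quad (k = 1, \ldots, \tfrac{N}{2}-1). \tag{†}$$ Then the dimension of $\mathcal{B}_{M,N}$ (with respect to the Zariski topology) equals $$2M + MN - \frac{N}{2} - 4 .$$ -/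

import Mathlib

open scoped LinearAlgebra.Projectivization

namespace RealFrame

/-- The product `ℙ((ℂ^M)^N) × ℙ(ℂ^{M×M})` of projective spaces: a point is a pair `([α], [A])`.
It carries the Zariski topology below (which is not the product topology). -/
@[ext]
structure BiProj (M N : ℕ) where
  frame : ℙ ℂ (Fin N → Fin M → ℂ)
  mat : ℙ ℂ (Matrix (Fin M) (Fin M) ℂ)

/-- Index set of the coordinates: the entries of the `N` vectors and those of the matrix. -/
abbrev Coord (M N : ℕ) : Type := (Fin N × Fin M) ⊕ (Fin M × Fin M)

/-- The coordinates of a pair `(α, A)`. -/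
def coords {M N : ℕ} (α : Fin N → Fin M → ℂ) (A : Matrix (Fin M) (Fin M) ℂ) : Coord M N → ℂ :=
  Sum.elim (fun p => α p.1 p.2) (fun p => A p.1 p.2)

/-- Bidegrees: `(1, 0)` for an entry of `α`, `(0, 1)` for an entry of `A`. -/
def biweight (M N : ℕ) : Coord M N → ℕ × ℕ :=
  Sum.elim (fun _ => (1, 0)) (fun _ => (0, 1))

/-- `f` is bihomogeneous of some bidegree. -/
def IsBihomogeneous {M N : ℕ} (f : MvPolynomial (Coord M N) ℂ) : Prop :=
  ∃ d : ℕ × ℕ, MvPolynomial.IsWeightedHomogeneous (biweight M N) f d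

/-- The polynomial `f` vanishes at the chosen representatives of `p`; for bihomogeneous `f` the
choice does not matter, see `vanishesAt_mk`. -/
def VanishesAt {M N : ℕ} (f : MvPolynomial (Coord M N) ℂ) (p : BiProj M N) : Prop :=
  MvPolynomial.eval (coords p.frame.rep p.mat.rep) f = 0

/-- The common zero locus of a family of polynomials. -/
def zeroLocus {M N : ℕ} (S : Set (MvPolynomial (Coord M N) ℂ)) : Set (BiProj M N) :=
  {p | ∀ f ∈ S, VanishesAt f p}

/-- The Zariski topology: the closed sets are the common zero loci of arbitrary families of
bihomogeneous polynomials. -/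
instance zariskiTopology (M N : ℕ) : TopologicalSpace (BiProj M N) :=
  TopologicalSpace.ofClosed
    {Z | ∃ S : Set (MvPolynomial (Coord M N) ℂ), (∀ f ∈ S, IsBihomogeneous f) ∧ Z = zeroLocus S}
    ⟨{1}, by
      rintro f rfl
      exact ⟨0, MvPolynomial.isWeightedHomogeneous_one ℂ _⟩, by
      ext p
      simp [zeroLocus, VanishesAt]⟩
    (by
      intro A hA
      refine ⟨{f | IsBihomogeneous f ∧ ∃ Z ∈ A, ∀ p ∈ Z, VanishesAt f p}, fun f hf => hf.1, ?_⟩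
      ext p
      constructor
      · rintro hp f ⟨_, Z, hZ, hf⟩
        exact hf p (hp Z hZ)
      · intro hp Z hZ
        obtain ⟨S, hS, hZS⟩ := hA hZ
        rw [hZS]
        intro f hf
        refine hp f ⟨hS f hf, Z, hZ, fun q hq => ?_⟩
        rw [hZS] at hq
        exact hq f hf)
    (by
      rintro _ ⟨S, hS, rfl⟩ _ ⟨T, hT, rfl⟩
      refine ⟨{h | ∃ f ∈ S, ∃ g ∈ T, h = f * g}, ?_, ?_⟩
      · rintro _ ⟨f, hf, g, hg, rfl⟩
        obtain ⟨d, hd⟩ := hS f hf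
        obtain ⟨e, he⟩ := hT g hg
        exact ⟨d + e, hd.mul he⟩
      · ext p
        constructor
        · rintro (hp | hp) _ ⟨f, hf, g, hg, rfl⟩
          · have := hp f hf
            simp only [VanishesAt] at this ⊢
            simp [this]
          · have := hp g hg
            simp only [VanishesAt] at this ⊢
            simp [this]
        · intro hp
          by_contra hcon
          simp only [Set.mem_union, not_or, zeroLocus, Set.mem_ofPred_eq, not_forall] at hcon
          obtain ⟨⟨f, hf, hfp⟩, ⟨g, hg, hgp⟩⟩ := hcon
          have := hp _ ⟨f, hf, g, hg, rfl⟩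
          simp only [VanishesAt, map_mul, mul_eq_zero] at this hfp hgp
          tauto)

/-- The affine variety `V^2_M` of complex symmetric matrices of rank at most two. -/
def symRankLeTwo (M : ℕ) : Set (Matrix (Fin M) (Fin M) ℂ) :=
  {A | A.IsSymm ∧ A.rank ≤ 2}

/-- The quadratic form `v ↦ vᵀ A v` (no complex conjugation). -/
def quad {M : ℕ} (A : Matrix (Fin M) (Fin M) ℂ) (v : Fin M → ℂ) : ℂ :=
  v ⬝ᵥ A.mulVec v

/-- For `N` even, the system `α₀ᵀ A α₀ = 0`, `α_{N/2}ᵀ A α_{N/2} = 0` and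
`α_kᵀ A α_k + α_{N-k}ᵀ A α_{N-k} = 0` for `k = 1, …, N/2 - 1`. -/
def SatisfiesDagger {M N : ℕ} (α : Fin N → Fin M → ℂ) (A : Matrix (Fin M) (Fin M) ℂ) : Prop :=
  (∀ i : Fin N, (i : ℕ) = 0 → quad A (α i) = 0) ∧
  (∀ i : Fin N, (i : ℕ) = N / 2 → quad A (α i) = 0) ∧
  (∀ k l : Fin N, 1 ≤ (k : ℕ) → (k : ℕ) < N / 2 → (k : ℕ) + (l : ℕ) = N →
    quad A (α k) + quad A (α l) = 0)

/-- The incidence variety of pairs `([α₀, …, α_{N-1}], [A])` in `ℙ((ℂ^M)^N) × ℙ(V^2_M)` that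
satisfy the system above. All conditions are independent of the choice of representatives, see
`mk_mem_incidence`. -/
def incidence (M N : ℕ) : Set (BiProj M N) :=
  {p | p.mat.rep ∈ symRankLeTwo M ∧ SatisfiesDagger p.frame.rep p.mat.rep}

/-! ### Independence of representatives -/

theorem eval_coords_smul {M N : ℕ} {f : MvPolynomial (Coord M N) ℂ} {d : ℕ × ℕ}
    (hf : MvPolynomial.IsWeightedHomogeneous (biweight M N) f d) (s t : ℂ)
    (α : Fin N → Fin M → ℂ) (A : Matrix (Fin M) (Fin M) ℂ) :
    MvPolynomial.eval (coords (s • α) (t • A)) f =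
      s ^ d.1 * t ^ d.2 * MvPolynomial.eval (coords α A) f := by
  rw [MvPolynomial.eval_eq', MvPolynomial.eval_eq', Finset.mul_sum]
  refine Finset.sum_congr rfl fun m hm => ?_
  have hd := hf (MvPolynomial.mem_support_iff.mp hm)
  rw [Finsupp.weight_apply, Finsupp.sum_fintype _ _ (by simp)] at hd
  have h1 : ∑ i, m (Sum.inl i) = d.1 := by
    rw [← hd]; simp [Prod.fst_sum, biweight]
  have h2 : ∑ i, m (Sum.inr i) = d.2 := by
    rw [← hd]; simp [Prod.snd_sum, biweight]
  rw [← h1, ← h2, Fintype.prod_sum_type, Fintype.prod_sum_type]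
  simp only [coords, Sum.elim_inl, Sum.elim_inr, Pi.smul_apply, Matrix.smul_apply, smul_eq_mul,
    mul_pow, Finset.prod_mul_distrib, Finset.prod_pow_eq_pow_sum]
  ring

theorem vanishesAt_mk {M N : ℕ} {f : MvPolynomial (Coord M N) ℂ} (hf : IsBihomogeneous f)
    {α : Fin N → Fin M → ℂ} (hα : α ≠ 0) {A : Matrix (Fin M) (Fin M) ℂ} (hA : A ≠ 0) :
    VanishesAt f ⟨Projectivization.mk ℂ α hα, Projectivization.mk ℂ A hA⟩ ↔
      MvPolynomial.eval (coords α A) f = 0 := by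
  obtain ⟨d, hd⟩ := hf
  obtain ⟨s, hs⟩ := Projectivization.exists_smul_eq_mk_rep ℂ α hα
  obtain ⟨t, ht⟩ := Projectivization.exists_smul_eq_mk_rep ℂ A hA
  simp only [VanishesAt]
  rw [← hs, ← ht, Units.smul_def, Units.smul_def, eval_coords_smul hd]
  simp

theorem quad_smul_smul {M : ℕ} (s t : ℂ) (A : Matrix (Fin M) (Fin M) ℂ) (v : Fin M → ℂ) :
    quad (t • A) (s • v) = t * s ^ 2 * quad A v := by
  simp only [quad, Matrix.smul_mulVec, Matrix.mulVec_smul, dotProduct_smul, smul_dotProduct,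
    smul_eq_mul]
  ring

theorem mk_mem_incidence {M N : ℕ} {α : Fin N → Fin M → ℂ} (hα : α ≠ 0)
    {A : Matrix (Fin M) (Fin M) ℂ} (hA : A ≠ 0) :
    (⟨Projectivization.mk ℂ α hα, Projectivization.mk ℂ A hA⟩ : BiProj M N) ∈ incidence M N ↔
      (A.IsSymm ∧ A.rank ≤ 2) ∧ SatisfiesDagger α A := by
  obtain ⟨s, hs⟩ := Projectivization.exists_smul_eq_mk_rep ℂ α hα
  obtain ⟨t, ht⟩ := Projectivization.exists_smul_eq_mk_rep ℂ A hA
  simp only [incidence, Set.mem_ofPred_eq]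
  rw [← hs, ← ht, Units.smul_def, Units.smul_def]
  have hs0 : (s : ℂ) ≠ 0 := s.ne_zero
  have ht0 : (t : ℂ) ≠ 0 := t.ne_zero
  have hrank : ((t : ℂ) • A).rank = A.rank := by
    refine le_antisymm ?_ ?_
    · have := Matrix.rank_mul_le_right (Matrix.scalar (Fin M) (t : ℂ)) A
      simpa [← Matrix.smul_eq_diagonal_mul] using this
    · have := Matrix.rank_mul_le_right (Matrix.scalar (Fin M) (t : ℂ)⁻¹) ((t : ℂ) • A)
      simpa [← Matrix.smul_eq_diagonal_mul, smul_smul, inv_mul_cancel₀ ht0] using this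
  have hsymm : ((t : ℂ) • A).IsSymm ↔ A.IsSymm := by
    simp only [Matrix.IsSymm, Matrix.transpose_smul]
    exact ⟨fun h => smul_right_injective _ ht0 h, fun h => by rw [h]⟩
  have hc : (t : ℂ) * (s : ℂ) ^ 2 ≠ 0 := mul_ne_zero ht0 (pow_ne_zero 2 hs0)
  simp only [symRankLeTwo, Set.mem_ofPred_eq, hrank, hsymm, SatisfiesDagger, Pi.smul_apply,
    quad_smul_smul, ← mul_add, mul_eq_zero, hc, false_or]

end RealFrame

namespace RealFrame

open MvPolynomial

/-! ### Transcendence degree -/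

/-! Both bounds on the length of chains of irreducible closed sets are proved directly, without a
fibre-dimension theorem.

Upper bound: an irreducible closed subset has a prime cone ideal (`coneIdeal_isPrime`), and a strict
inclusion of sets strictly raises the transcendence degree of the quotient (`quotientTrdeg_lt`).
This degree is at least 2, one for each scaling (`two_le_quotientTrdeg_coneIdeal`). It is at most 2M
+ MN - N/2 - 2: in the fraction field a nonzero symmetric matrix of rank at most two depends
algebraically on 2M - 1 entries, and each of the N/2 + 1 equations makes one coordinate of its own
vector algebraic over the rest (`trdeg_le_of_symm_rank_two_of_quadSum`). Subtracting 2 gives the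
claim.

Lower bound: the matrix is taken as a symmetrized product of two linear forms, the two isotropic
vectors in the kernel of one form. For a pair, the substitution z = α_k - iα_{N-k}, w = α_k +
iα_{N-k} turns the equation into wᵀAz = 0, which is linear in w and can be solved polynomially.
Freeing the parameters one at a time yields a chain of closures of images of affine spaces. A
bihomogeneous polynomial attached to each parameter shows that every step is strict, so the
dimension of the image need not be computed (`le_topologicalKrullDim_incidence_of_parametrization`).
One parameter is fixed to 1 to keep the frame nonzero. -/

theorem trdeg_lt_of_surjective_of_not_injective {k A B : Type} [Field k] [CommRing A] [IsDomain A]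
    [CommRing B] [IsDomain B] [Algebra k A] [Algebra k B] (f : A →ₐ[k] B)
    (hf : Function.Surjective f) (hinj : ¬ Function.Injective f)
    (hfin : Algebra.trdeg k A < Cardinal.aleph0) : Algebra.trdeg k B < Algebra.trdeg k A := by
  refine lt_of_le_of_ne (trdeg_le_of_surjective f hf) fun heq => hinj ?_
  obtain ⟨s, hs⟩ := exists_isTranscendenceBasis k B
  have hcard : Cardinal.mk s = Algebra.trdeg k B := hs.cardinalMk_eq_trdeg
  choose y hy using fun x : s => hf x
  have hcomp : (fun x : s => f (y x)) = ((↑) : s → B) := funext hy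
  have hyind : AlgebraicIndependent k y := by
    refine AlgebraicIndependent.of_comp f ?_
    rw [show f ∘ y = ((↑) : s → B) from hcomp]
    exact hs.1
  -- If the degrees agreed, the lift of a transcendence basis of `B` would be one of `A`.
  have hybasis : IsTranscendenceBasis k y :=
    hyind.isTranscendenceBasis_of_trdeg_le hfin (by rw [hcard, heq])
  have halg : Algebra.IsAlgebraic (Algebra.adjoin k (Set.range y)) A := hybasis.isAlgebraic
  rw [injective_iff_map_eq_zero]
  intro q hq
  by_contra hq0
  -- A nonzero kernel element, being algebraic, divides a nonzero polynomial in the lifts; `f` kills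
  -- that polynomial, against independence in `B`.
  obtain ⟨r, hr0, u, hu⟩ := (halg.isAlgebraic q).exists_nonzero_dvd (mem_nonZeroDivisors_of_ne_zero hq0)
  obtain ⟨r, hr⟩ := r
  rw [Algebra.adjoin_range_eq_range_aeval] at hr
  obtain ⟨p, rfl⟩ := hr
  have h1 : f (aeval y p) = 0 := by
    have : (aeval y p : A) = q * u := hu
    rw [this, map_mul, hq, zero_mul]
  have h2 : aeval ((↑) : s → B) p = 0 := by
    rw [← hcomp, ← h1, ← MvPolynomial.comp_aeval_apply]
  have h3 : p = 0 := (injective_iff_map_eq_zero _).1 hs.1 p h2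
  exact hr0 (Subtype.ext (by simp [h3]))

/-- The hypothesis is applied to the relative algebraic closure of k(X), which contains the roots of
quadratics over itself. Later arguments then only need to solve linear and quadratic equations. -/
theorem trdeg_le_card_of_forall_intermediateField {k K : Type} [Field k] [Field K] [Algebra k K]
    (X : Finset K)
    (h : ∀ E : IntermediateField k K, (X : Set K) ⊆ E →
      (∀ x a b c : K, a ∈ E → b ∈ E → c ∈ E → a ≠ 0 → a * x ^ 2 + b * x + c = 0 → x ∈ E) →
      E = ⊤) : Algebra.trdeg k K ≤ X.card := by
  set F := IntermediateField.adjoin k (X : Set K)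
  have hX : (X : Set K) ⊆ F := IntermediateField.subset_adjoin k _
  have htop : (algebraicClosure F K).restrictScalars k = ⊤ := by
    apply h
    · intro x hx
      exact (algebraicClosure F K).algebraMap_mem ⟨x, hX hx⟩
    · intro x a b c ha hb hc ha0 hx
      set L := algebraicClosure F K
      have hxL : IsAlgebraic L x := by
        refine ⟨Polynomial.C ⟨a, ha⟩ * Polynomial.X ^ 2 + Polynomial.C ⟨b, hb⟩ * Polynomial.X +
          Polynomial.C ⟨c, hc⟩, ?_, ?_⟩
        · intro h0
          have := congrArg (fun p => Polynomial.coeff p 2) h0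
          simp at this
          exact ha0 (congrArg Subtype.val this)
        · simpa using hx
      exact (mem_algebraicClosure_iff).2 (hxL.restrictScalars F)
  have halg : Algebra.IsAlgebraic F K := by
    rw [← algebraicClosure.eq_top_iff]
    exact IntermediateField.restrictScalars_injective k htop
  have : Algebra.IsAlgebraic (Algebra.adjoin k (X : Set K)) K :=
    IntermediateField.isAlgebraic_adjoin_iff_top.1 halg
  simpa using Algebra.IsAlgebraic.trdeg_le_cardinalMk k (X : Set K)

/-! ### Generators up to algebraic dependence -/

/-- The subfield `E` contains the roots of every quadratic equation over it. -/
def ClosedUnderQuadratics {K : Type} [Field K] [Algebra ℂ K] (E : IntermediateField ℂ K) : Prop :=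
  ∀ x a b c : K, a ∈ E → b ∈ E → c ∈ E → a ≠ 0 → a * x ^ 2 + b * x + c = 0 → x ∈ E

/-- The value `xᵀ A x` over an arbitrary commutative ring. -/
def quadSum {R : Type} [CommRing R] {M : ℕ} (A : Fin M → Fin M → R) (x : Fin M → R) : R :=
  ∑ a, ∑ b, A a b * (x a * x b)

/-- If some principal 2×2 minor is nonzero, its two rows determine the matrix through the 3×3
minors; they share an entry by symmetry, which leaves 2M - 1. Otherwise the matrix has rank one and
a single row suffices. -/
theorem exists_finset_generating_symm_rank_two {K : Type} [Field K] [Algebra ℂ K] {M : ℕ}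
    (A : Fin M → Fin M → K) (hsymm : ∀ a b, A a b = A b a)
    (hminor : ∀ r c : Fin 3 → Fin M, (Matrix.of fun i j => A (r i) (c j)).det = 0)
    (hA : ∃ a b, A a b ≠ 0) :
    ∃ X : Finset K, X.card + 1 ≤ 2 * M ∧
      ∀ E : IntermediateField ℂ K, (X : Set K) ⊆ E → ∀ a b, A a b ∈ E := by
  classical
  by_cases h : ∃ j k, A j j * A k k - A j k ^ 2 ≠ 0
  · obtain ⟨j, k, hjk⟩ := h
    refine ⟨Finset.univ.image (A j) ∪ (Finset.univ.erase j).image (A k), ?_, ?_⟩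
    · have h1 := Finset.card_union_le (Finset.univ.image (A j)) ((Finset.univ.erase j).image (A k))
      have h2 := Finset.card_image_le (s := Finset.univ) (f := A j)
      have h3 := Finset.card_image_le (s := Finset.univ.erase j) (f := A k)
      rw [Finset.card_erase_of_mem (Finset.mem_univ j)] at h3
      simp only [Finset.card_univ, Fintype.card_fin] at h2 h3
      have := j.pos
      omega
    · intro E hE a b
      have hj : ∀ c, A j c ∈ E := fun c => hE (by simp)
      have hk : ∀ c, A k c ∈ E := fun c => by
        by_cases hc : c = j
        · rw [hc, hsymm]; exact hj k
        · refine hE ?_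
          simp only [Finset.coe_union, Finset.coe_image, Set.mem_union, Set.mem_image]
          exact Or.inr ⟨c, by simpa using hc, rfl⟩
      have hm := hminor ![j, k, a] ![j, k, b]
      simp only [Matrix.det_fin_three, Matrix.of_apply, Matrix.cons_val] at hm
      rw [hsymm k j, hsymm a j, hsymm a k] at hm
      have hab : A a b = -(A j k * A k b * A j a - A j j * A k b * A k a + A j b * A j k * A k a - A j b * A k k * A j a) / (A j j * A k k - A j k ^ 2) := by
        rw [eq_div_iff hjk]
        linear_combination hm
      rw [hab]
      exact div_mem (neg_mem (by
        repeat' first | apply sub_mem | apply add_mem | apply mul_mem | apply hj | apply hk))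
        (sub_mem (mul_mem (hj _) (hk _)) (pow_mem (hj _) _))
  · push Not at h
    obtain ⟨a, b, hab⟩ := hA
    have haa : A a a ≠ 0 := by
      intro h0
      have := h a b
      rw [h0] at this
      exact hab (by simpa using this)
    refine ⟨Finset.univ.image (A a), ?_, ?_⟩
    · have h2 := Finset.card_image_le (s := Finset.univ) (f := A a)
      simp only [Finset.card_univ, Fintype.card_fin] at h2
      have := a.pos
      omega
    · intro E hE c d
      have ha : ∀ c, A a c ∈ E := fun c => hE (by simp)
      have hm := hminor ![a, c, d] ![a, c, d]
      simp only [Matrix.det_fin_three, Matrix.of_apply, Matrix.cons_val] at hm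
      rw [hsymm c a, hsymm d a, hsymm d c] at hm
      have h1 := h a c
      -- Jacobi's identity: `A a a` times the 3×3 determinant is the product of two principal 2×2
      -- minors minus this square.
      have h3 : (A a a * A c d - A a c * A a d) ^ 2 = 0 := by
        linear_combination -A a a * hm + (A a a * A d d - A a d ^ 2) * h1
      have h4 : A c d = A a c * A a d / A a a := by
        rw [eq_div_iff haa]
        linear_combination (pow_eq_zero_iff two_ne_zero).1 h3
      rw [h4]
      exact div_mem (mul_mem (ha _) (ha _)) (ha _)

theorem quadSum_eq_of_index {R : Type} [CommRing R] {M : ℕ} (A : Fin M → Fin M → R)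
    (hsymm : ∀ a b, A a b = A b a) (x : Fin M → R) (j : Fin M) :
    quadSum A x = A j j * x j ^ 2 + 2 * (∑ b ∈ Finset.univ.erase j, A j b * x b) * x j +
      ∑ a ∈ Finset.univ.erase j, ∑ b ∈ Finset.univ.erase j, A a b * (x a * x b) := by
  have h1 : ∀ a, ∑ b, A a b * (x a * x b) =
      A a j * (x a * x j) + ∑ b ∈ Finset.univ.erase j, A a b * (x a * x b) :=
    fun a => (Finset.add_sum_erase _ _ (Finset.mem_univ j)).symm
  rw [quadSum, ← Finset.add_sum_erase _ _ (Finset.mem_univ j)]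
  simp only [h1, Finset.sum_add_distrib]
  have h2 : ∑ b ∈ Finset.univ.erase j, A j b * (x j * x b) =
      (∑ b ∈ Finset.univ.erase j, A j b * x b) * x j := by
    rw [Finset.sum_mul]; exact Finset.sum_congr rfl fun b _ => by ring
  have h3 : ∑ a ∈ Finset.univ.erase j, A a j * (x a * x j) =
      (∑ b ∈ Finset.univ.erase j, A j b * x b) * x j := by
    rw [Finset.sum_mul]; exact Finset.sum_congr rfl fun b _ => by rw [hsymm b j]; ring
  rw [h2, h3]
  ring

/-- With a nonzero diagonal entry the form is a genuine quadratic in that coordinate. With zero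
diagonal and `A j k ≠ 0` it is affine in `x j`: either its slope is nonzero and `x j` can be solved
for, or the vanishing of the slope is a linear relation that gives `x k`. The index must not depend
on `E`, since the generating set is chosen before `E`. -/
theorem exists_index_mem_of_quadSum_mem {K : Type} [Field K] [Algebra ℂ K] {M : ℕ}
    (A : Fin M → Fin M → K) (hsymm : ∀ a b, A a b = A b a) (hA : ∃ a b, A a b ≠ 0)
    (x : Fin M → K) :
    ∃ j, ∀ E : IntermediateField ℂ K, ClosedUnderQuadratics E → (∀ a b, A a b ∈ E) →
      quadSum A x ∈ E → (∀ b, b ≠ j → x b ∈ E) → x j ∈ E := by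
  have hchar : (2 : K) ≠ 0 := by
    have := charZero_of_injective_algebraMap (algebraMap ℂ K).injective
    exact two_ne_zero
  have hmem2 : ∀ E : IntermediateField ℂ K, (2 : K) ∈ E := fun E => ofNat_mem E 2
  have hs : ∀ (E : IntermediateField ℂ K) (j : Fin M), (∀ a b, A a b ∈ E) →
      (∀ b, b ≠ j → x b ∈ E) → ∑ b ∈ Finset.univ.erase j, A j b * x b ∈ E := fun E j hE hx =>
    sum_mem fun b hb => mul_mem (hE _ _) (hx b (Finset.ne_of_mem_erase hb))
  have ht : ∀ (E : IntermediateField ℂ K) (j : Fin M), (∀ a b, A a b ∈ E) →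
      (∀ b, b ≠ j → x b ∈ E) → ∑ a ∈ Finset.univ.erase j, ∑ b ∈ Finset.univ.erase j,
        A a b * (x a * x b) ∈ E := fun E j hE hx =>
    sum_mem fun a ha => sum_mem fun b hb => mul_mem (hE _ _)
      (mul_mem (hx a (Finset.ne_of_mem_erase ha)) (hx b (Finset.ne_of_mem_erase hb)))
  by_cases h : ∃ j, A j j ≠ 0
  · obtain ⟨j, hj⟩ := h
    refine ⟨j, fun E hE hAE hq hx => ?_⟩
    refine hE (x j) (A j j) (2 * ∑ b ∈ Finset.univ.erase j, A j b * x b)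
      ((∑ a ∈ Finset.univ.erase j, ∑ b ∈ Finset.univ.erase j, A a b * (x a * x b)) - quadSum A x)
      (hAE _ _) (mul_mem (hmem2 E) (hs E j hAE hx)) (sub_mem (ht E j hAE hx) hq) hj ?_
    rw [quadSum_eq_of_index A hsymm x j]
    ring
  · push Not at h
    obtain ⟨j, k, hjk⟩ := hA
    by_cases hsum : ∑ b ∈ Finset.univ.erase j, A j b * x b = 0
    · have hkj : k ≠ j := by
        rintro rfl
        exact hjk (h k)
      refine ⟨k, fun E hE hAE hq hx => ?_⟩
      rw [← Finset.add_sum_erase _ _ (Finset.mem_erase.2 ⟨hkj, Finset.mem_univ k⟩)] at hsum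
      have hxk : x k = -(∑ b ∈ (Finset.univ.erase j).erase k, A j b * x b) / A j k := by
        rw [eq_div_iff hjk]
        linear_combination hsum
      rw [hxk]
      exact div_mem (neg_mem (sum_mem fun b hb => mul_mem (hAE _ _)
        (hx b (Finset.ne_of_mem_erase hb)))) (hAE _ _)
    · refine ⟨j, fun E hE hAE hq hx => ?_⟩
      have hq' := quadSum_eq_of_index A hsymm x j
      rw [h j] at hq'
      have hxj : x j = (quadSum A x - ∑ a ∈ Finset.univ.erase j, ∑ b ∈ Finset.univ.erase j,
          A a b * (x a * x b)) / (2 * ∑ b ∈ Finset.univ.erase j, A j b * x b) := by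
        rw [eq_div_iff (mul_ne_zero hchar hsum)]
        linear_combination -hq'
      rw [hxj]
      exact div_mem (sub_mem hq (ht E j hAE hx)) (mul_mem (hmem2 E) (hs E j hAE hx))

theorem trdeg_le_of_symm_rank_two_of_quadSum {K : Type} [Field K] [Algebra ℂ K] {M N : ℕ}
    (hN : N ≠ 0) (A : Fin M → Fin M → K) (α : Fin N → Fin M → K) (hsymm : ∀ a b, A a b = A b a)
    (hminor : ∀ r c : Fin 3 → Fin M, (Matrix.of fun i j => A (r i) (c j)).det = 0)
    (hA : ∃ a b, A a b ≠ 0)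
    (hq : ∀ i : Fin N, (i : ℕ) ≤ N / 2 → quadSum A (α i) = 0 ∨
      ∃ l : Fin N, N / 2 < (l : ℕ) ∧ quadSum A (α i) + quadSum A (α l) = 0)
    (hgen : ∀ E : IntermediateField ℂ K, (∀ a b, A a b ∈ E) → (∀ i b, α i b ∈ E) → E = ⊤) :
    ∃ n : ℕ, Algebra.trdeg ℂ K ≤ n ∧ n + (N / 2 + 2) ≤ 2 * M + M * N := by
  classical
  obtain ⟨X, hXcard, hX⟩ := exists_finset_generating_symm_rank_two A hsymm hminor hA
  choose j hj using fun i => exists_index_mem_of_quadSum_mem A hsymm hA (α i)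
  -- One coordinate is dropped from each vector of index at most N/2. Vectors of larger index are
  -- kept whole, so the partner's value in `hq` is available without circularity.
  let T : Finset (Fin N × Fin M) := Finset.univ.filter fun p => ¬ ((p.1 : ℕ) ≤ N / 2 ∧ p.2 = j p.1)
  have hT : T.card + (N / 2 + 1) = N * M := by
    have h1 := Finset.card_filter_add_card_filter_not (s := (Finset.univ : Finset (Fin N × Fin M)))
      (fun p => ((p.1 : ℕ) ≤ N / 2 ∧ p.2 = j p.1))
    have h2 : (Finset.univ.filter fun p : Fin N × Fin M =>
        ((p.1 : ℕ) ≤ N / 2 ∧ p.2 = j p.1)).card = N / 2 + 1 := by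
      have : (Finset.univ.filter fun p : Fin N × Fin M => ((p.1 : ℕ) ≤ N / 2 ∧ p.2 = j p.1)) =
          (Finset.univ : Finset (Fin (N / 2 + 1))).image
            (fun i : Fin (N / 2 + 1) => ((⟨i, by omega⟩ : Fin N), j ⟨i, by omega⟩)) := by
        ext ⟨i, b⟩
        simp only [Finset.mem_filter, Finset.mem_univ, true_and, Finset.mem_image, Prod.mk.injEq]
        constructor
        · rintro ⟨hi, rfl⟩
          exact ⟨⟨i, by omega⟩, rfl, rfl⟩
        · rintro ⟨c, rfl, rfl⟩
          exact ⟨by have := c.2; simp only; omega, rfl⟩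
      rw [this, Finset.card_image_of_injective, Finset.card_univ, Fintype.card_fin]
      intro a b hab
      simpa [Fin.ext_iff] using congrArg Prod.fst hab
    rw [h2] at h1
    simp only [Finset.card_univ, Fintype.card_prod, Fintype.card_fin] at h1
    simp only [T]
    omega
  refine ⟨(X ∪ T.image fun p => α p.1 p.2).card,
    trdeg_le_card_of_forall_intermediateField _ fun E hE hEq => ?_, ?_⟩
  · have hAE : ∀ a b, A a b ∈ E := hX E fun y hy => hE (by simp [Finset.mem_coe.1 hy])
    have hαE : ∀ (i : Fin N) (b : Fin M), ¬ ((i : ℕ) ≤ N / 2 ∧ b = j i) → α i b ∈ E := fun i b hib => by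
      refine hE ?_
      simp only [Finset.coe_union, Finset.coe_image, Set.mem_union, Set.mem_image]
      exact Or.inr ⟨(i, b), by simpa [T] using hib, rfl⟩
    refine hgen E hAE fun i b => ?_
    by_cases hib : (i : ℕ) ≤ N / 2 ∧ b = j i
    · obtain ⟨hi, rfl⟩ := hib
      refine hj i E hEq hAE ?_ fun b hb => hαE i b fun h => hb h.2
      rcases hq i hi with h0 | ⟨l, hl, h0⟩
      · rw [h0]; exact zero_mem E
      · rw [eq_neg_of_add_eq_zero_left h0]
        exact neg_mem (sum_mem fun a _ => sum_mem fun b _ => mul_mem (hAE _ _)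
          (mul_mem (hαE _ _ fun h => by omega) (hαE _ _ fun h => by omega)))
    · exact hαE i b hib
  · have h1 := Finset.card_union_le X (T.image fun p => α p.1 p.2)
    have h2 := Finset.card_image_le (s := T) (f := fun p => α p.1 p.2)
    rw [mul_comm M N]
    omega

/-! ### Vanishing ideals of bihomogeneous cones -/

/-- Restriction of a polynomial to the plane `(s, t) ↦ (s α, t A)`. -/
noncomputable def restrictPlane {M N : ℕ} (α : Fin N → Fin M → ℂ)
    (A : Matrix (Fin M) (Fin M) ℂ) : MvPolynomial (Coord M N) ℂ →ₐ[ℂ] MvPolynomial (Fin 2) ℂ :=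
  aeval (Sum.elim (fun p => C (α p.1 p.2) * X 0) (fun p => C (A p.1 p.2) * X 1))

theorem eval_restrictPlane {M N : ℕ} (α : Fin N → Fin M → ℂ) (A : Matrix (Fin M) (Fin M) ℂ)
    (f : MvPolynomial (Coord M N) ℂ) (v : Fin 2 → ℂ) :
    eval v (restrictPlane α A f) = eval (coords (v 0 • α) (v 1 • A)) f := by
  induction f using MvPolynomial.induction_on with
  | C a => simp [restrictPlane]
  | add p q hp hq => simp [hp, hq]
  | mul_X p i hp =>
    rw [map_mul, map_mul, hp, map_mul, eval_X]
    congr 1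
    rcases i with i | i <;> simp [restrictPlane, coords, mul_comm]

theorem restrictPlane_eq_zero_iff {M N : ℕ} (α : Fin N → Fin M → ℂ)
    (A : Matrix (Fin M) (Fin M) ℂ) (f : MvPolynomial (Coord M N) ℂ) :
    restrictPlane α A f = 0 ↔ ∀ s t : ℂ, eval (coords (s • α) (t • A)) f = 0 := by
  constructor
  · intro h s t
    simpa [h] using (eval_restrictPlane α A f ![s, t]).symm
  · intro h
    refine MvPolynomial.funext fun v => ?_
    rw [eval_restrictPlane, h, map_zero]

theorem restrictPlane_eq_zero_iff_of_isWeightedHomogeneous {M N : ℕ} {α : Fin N → Fin M → ℂ}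
    {A : Matrix (Fin M) (Fin M) ℂ} {f : MvPolynomial (Coord M N) ℂ} {d : ℕ × ℕ}
    (hf : IsWeightedHomogeneous (biweight M N) f d) :
    restrictPlane α A f = 0 ↔ eval (coords α A) f = 0 := by
  rw [restrictPlane_eq_zero_iff]
  constructor
  · intro h
    simpa using h 1 1
  · intro h s t
    rw [eval_coords_smul hf, h, mul_zero]

theorem restrictPlane_of_isWeightedHomogeneous {M N : ℕ} (α : Fin N → Fin M → ℂ)
    (A : Matrix (Fin M) (Fin M) ℂ) {f : MvPolynomial (Coord M N) ℂ} {d : ℕ × ℕ}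
    (hf : IsWeightedHomogeneous (biweight M N) f d) :
    restrictPlane α A f =
      monomial (Finsupp.single 0 d.1 + Finsupp.single 1 d.2) (eval (coords α A) f) := by
  refine MvPolynomial.funext fun v => ?_
  rw [eval_restrictPlane, eval_coords_smul hf, eval_monomial,
    Finsupp.prod_add_index' (by simp) (by simp [pow_add])]
  simp [mul_comm]

/-- On the plane, components of different bidegrees become multiples of different monomials, so they
cannot cancel. -/
theorem eval_weightedHomogeneousComponent_of_restrictPlane_eq_zero {M N : ℕ}
    {α : Fin N → Fin M → ℂ} {A : Matrix (Fin M) (Fin M) ℂ} {f : MvPolynomial (Coord M N) ℂ}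
    (h : restrictPlane α A f = 0) (d : ℕ × ℕ) :
    eval (coords α A) (weightedHomogeneousComponent (biweight M N) d f) = 0 := by
  classical
  have hfin := weightedHomogeneousComponent_finsupp (w := biweight M N) f
  have hsum := finsum_weightedHomogeneousComponent (biweight M N) f
  rw [finsum_eq_sum _ hfin] at hsum
  rw [← hsum, map_sum] at h
  simp_rw [restrictPlane_of_isWeightedHomogeneous α A
    (weightedHomogeneousComponent_isWeightedHomogeneous _ f)] at h
  have h2 := congrArg (coeff (Finsupp.single 0 d.1 + Finsupp.single 1 d.2)) h
  have hinj : ∀ e : ℕ × ℕ, (Finsupp.single (0 : Fin 2) e.1 + Finsupp.single 1 e.2 =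
      Finsupp.single 0 d.1 + Finsupp.single 1 d.2) ↔ e = d := by
    intro e
    constructor
    · intro he
      have h0 := DFunLike.congr_fun he 0
      have h1 := DFunLike.congr_fun he 1
      simp at h0 h1
      exact Prod.ext h0 h1
    · rintro rfl; rfl
  simp only [coeff_sum, coeff_monomial, hinj, coeff_zero, Finset.sum_ite_eq'] at h2
  by_cases hd : d ∈ hfin.toFinset
  · rwa [if_pos hd] at h2
  · have : weightedHomogeneousComponent (biweight M N) d f = 0 := by
      by_contra h0
      exact hd (hfin.mem_toFinset.2 h0)
    rw [this, map_zero]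

/-- The ideal of the polynomials that vanish on the cone over a set of points. -/
noncomputable def coneIdeal {M N : ℕ} (Z : Set (BiProj M N)) :
    Ideal (MvPolynomial (Coord M N) ℂ) :=
  ⨅ p ∈ Z, RingHom.ker (restrictPlane p.frame.rep p.mat.rep)

theorem mem_coneIdeal {M N : ℕ} {Z : Set (BiProj M N)} {f : MvPolynomial (Coord M N) ℂ} :
    f ∈ coneIdeal Z ↔ ∀ p ∈ Z, restrictPlane p.frame.rep p.mat.rep f = 0 := by
  simp [coneIdeal, RingHom.mem_ker]

theorem isClosed_zeroLocus {M N : ℕ} {S : Set (MvPolynomial (Coord M N) ℂ)}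
    (hS : ∀ f ∈ S, IsBihomogeneous f) : IsClosed (zeroLocus S) :=
  ⟨S, hS, compl_compl _⟩

theorem exists_zeroLocus_of_isClosed {M N : ℕ} {Z : Set (BiProj M N)} (hZ : IsClosed Z) :
    ∃ S : Set (MvPolynomial (Coord M N) ℂ), (∀ f ∈ S, IsBihomogeneous f) ∧ Z = zeroLocus S := by
  obtain ⟨S, hS, h⟩ := hZ.isOpen_compl
  exact ⟨S, hS, by rw [← h, compl_compl]⟩

/-- The points at which all bihomogeneous components of `f` vanish. -/
noncomputable def componentsLocus {M N : ℕ} (f : MvPolynomial (Coord M N) ℂ) :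
    Set (BiProj M N) :=
  zeroLocus (Set.range fun d => weightedHomogeneousComponent (biweight M N) d f)

theorem isClosed_componentsLocus {M N : ℕ} (f : MvPolynomial (Coord M N) ℂ) :
    IsClosed (componentsLocus f) := by
  refine isClosed_zeroLocus ?_
  rintro _ ⟨d, rfl⟩
  exact ⟨d, weightedHomogeneousComponent_isWeightedHomogeneous _ _⟩

theorem mem_componentsLocus {M N : ℕ} {f : MvPolynomial (Coord M N) ℂ} {p : BiProj M N} :
    p ∈ componentsLocus f ↔ restrictPlane p.frame.rep p.mat.rep f = 0 := by
  classical
  constructor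
  · intro h
    have hfin := weightedHomogeneousComponent_finsupp (w := biweight M N) f
    rw [← finsum_weightedHomogeneousComponent (biweight M N) f, finsum_eq_sum _ hfin, map_sum]
    refine Finset.sum_eq_zero fun d _ => ?_
    rw [restrictPlane_eq_zero_iff_of_isWeightedHomogeneous
      (weightedHomogeneousComponent_isWeightedHomogeneous _ _)]
    exact h _ ⟨d, rfl⟩
  · rintro h _ ⟨d, rfl⟩
    exact eval_weightedHomogeneousComponent_of_restrictPlane_eq_zero h d

/-- Restriction to the plane over a point lands in a domain, so a product in the ideal puts each
point of `Z` in one of two closed sets, and irreducibility selects one of them. -/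
theorem coneIdeal_isPrime {M N : ℕ} {Z : Set (BiProj M N)} (hZ : IsIrreducible Z) :
    (coneIdeal Z).IsPrime := by
  refine Ideal.isPrime_iff.2 ⟨?_, fun {f g} hfg => ?_⟩
  · obtain ⟨p, hp⟩ := hZ.1
    rw [Ideal.ne_top_iff_one, mem_coneIdeal]
    intro h
    simpa using h p hp
  · have hsub : Z ⊆ componentsLocus f ∪ componentsLocus g := by
      intro p hp
      have := mem_coneIdeal.1 hfg p hp
      rw [map_mul, mul_eq_zero] at this
      exact this.imp mem_componentsLocus.2 mem_componentsLocus.2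
    have := (isPreirreducible_iff_isClosed_union_isClosed.1 hZ.2) _ _
      (isClosed_componentsLocus f) (isClosed_componentsLocus g) hsub
    exact this.imp (fun h => mem_coneIdeal.2 fun p hp => mem_componentsLocus.1 (h hp))
      (fun h => mem_coneIdeal.2 fun p hp => mem_componentsLocus.1 (h hp))

theorem coneIdeal_anti {M N : ℕ} {Z W : Set (BiProj M N)} (h : Z ⊆ W) :
    coneIdeal W ≤ coneIdeal Z := fun _ hf =>
  mem_coneIdeal.2 fun p hp => mem_coneIdeal.1 hf p (h hp)

/-! ### Transcendence degree of the coordinate ring of a cone -/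

/-- The transcendence degree of the quotient by an ideal, as a natural number. -/
noncomputable def quotientTrdeg {σ : Type} (P : Ideal (MvPolynomial σ ℂ)) : ℕ :=
  Cardinal.toNat (Algebra.trdeg ℂ (MvPolynomial σ ℂ ⧸ P))

theorem quotientTrdeg_lt {σ : Type} [Finite σ] {P Q : Ideal (MvPolynomial σ ℂ)} [P.IsPrime]
    [Q.IsPrime] (h : P < Q) : quotientTrdeg Q < quotientTrdeg P := by
  have hfin := trdeg_lt_aleph0_of_finiteType (R := ℂ) (S := MvPolynomial σ ℂ ⧸ P)
  have hlt := trdeg_lt_of_surjective_of_not_injective (Ideal.Quotient.factorₐ ℂ h.le)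
    (Ideal.Quotient.factor_surjective h.le) (fun hinj => ?_) hfin
  · exact Cardinal.toNat_lt_toNat hlt hfin
  · obtain ⟨f, hfQ, hfP⟩ := Set.exists_of_ssubset h
    refine hfP (Ideal.Quotient.eq_zero_iff_mem.1 (hinj ?_))
    rw [map_zero]
    exact Ideal.Quotient.eq_zero_iff_mem.2 hfQ

/-- Setting the coordinates of the frame to zero. -/
noncomputable def forgetFrame (M N : ℕ) :
    MvPolynomial (Coord M N) ℂ →ₐ[ℂ] MvPolynomial (Coord M N) ℂ :=
  aeval (Sum.elim (fun _ => 0) (fun p => X (Sum.inr p)))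

theorem eval_forgetFrame {M N : ℕ} (α : Fin N → Fin M → ℂ) (A : Matrix (Fin M) (Fin M) ℂ)
    (f : MvPolynomial (Coord M N) ℂ) :
    eval (coords α A) (forgetFrame M N f) = eval (coords 0 A) f := by
  induction f using MvPolynomial.induction_on with
  | C a => simp [forgetFrame]
  | add p q hp hq => simp [hp, hq]
  | mul_X p i hp =>
    rw [map_mul, map_mul, hp, map_mul, eval_X]
    congr 1
    rcases i with i | i <;> simp [forgetFrame, coords]

/-- The cone strictly contains its slice α = 0 (take s = 0), which strictly contains the origin; `Q`
and `m` are the corresponding primes. -/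
theorem two_le_quotientTrdeg_coneIdeal {M N : ℕ} {Z : Set (BiProj M N)} (hZ : IsIrreducible Z) :
    2 ≤ quotientTrdeg (coneIdeal Z) := by
  have hP := coneIdeal_isPrime hZ
  obtain ⟨p, hp⟩ := hZ.1
  set Q := (coneIdeal Z).comap (forgetFrame M N)
  have hQ : Q.IsPrime := Ideal.IsPrime.comap _
  set m : Ideal (MvPolynomial (Coord M N) ℂ) := RingHom.ker (eval (0 : Coord M N → ℂ))
  have hm : m.IsPrime := RingHom.ker_isPrime _
  have hcoords : coords (0 : Fin N → Fin M → ℂ) (0 : Matrix (Fin M) (Fin M) ℂ) = 0 := by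
    ext i
    rcases i with i | i <;> rfl
  have hPQ : coneIdeal Z < Q := by
    refine lt_of_le_of_ne (fun f hf => ?_) fun heq => ?_
    · rw [Ideal.mem_comap, mem_coneIdeal]
      intro q hq
      rw [restrictPlane_eq_zero_iff]
      intro s t
      rw [eval_forgetFrame]
      simpa using (restrictPlane_eq_zero_iff _ _ _).1 (mem_coneIdeal.1 hf q hq) 0 t
    · apply p.frame.rep_nonzero
      ext i b
      have : (X (Sum.inl (i, b)) : MvPolynomial (Coord M N) ℂ) ∈ coneIdeal Z := by
        rw [heq, Ideal.mem_comap]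
        simp [forgetFrame]
      simpa [coords] using (restrictPlane_eq_zero_iff _ _ _).1 (mem_coneIdeal.1 this p hp) 1 1
  have hQm : Q < m := by
    refine lt_of_le_of_ne (fun f hf => ?_) fun heq => ?_
    · rw [Ideal.mem_comap, mem_coneIdeal] at hf
      have := (restrictPlane_eq_zero_iff _ _ _).1 (hf p hp) 0 0
      rw [eval_forgetFrame, zero_smul, hcoords] at this
      exact this
    · apply p.mat.rep_nonzero
      ext a b
      have : (X (Sum.inr (a, b)) : MvPolynomial (Coord M N) ℂ) ∈ Q := by
        rw [heq]
        simp [m, RingHom.mem_ker]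
      have := (restrictPlane_eq_zero_iff _ _ _).1 (mem_coneIdeal.1 this p hp) 1 1
      rw [eval_forgetFrame] at this
      simpa [coords] using this
  have h1 := quotientTrdeg_lt hPQ
  have h2 := quotientTrdeg_lt hQm
  omega

/-! ### The upper bound for the dimension -/

theorem quad_eq_quadSum {M : ℕ} (A : Matrix (Fin M) (Fin M) ℂ) (v : Fin M → ℂ) :
    quad A v = quadSum A v := by
  simp only [quad, quadSum, dotProduct, Matrix.mulVec, Finset.mul_sum]
  exact Finset.sum_congr rfl fun a _ => Finset.sum_congr rfl fun b _ => by ring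

theorem map_quadSum {R S : Type} [CommRing R] [CommRing S] (θ : R →+* S) {M : ℕ}
    (A : Fin M → Fin M → R) (x : Fin M → R) :
    θ (quadSum A x) = quadSum (fun a b => θ (A a b)) (fun a => θ (x a)) := by
  simp [quadSum]

theorem rank_smul_le {M : ℕ} (t : ℂ) (A : Matrix (Fin M) (Fin M) ℂ) : (t • A).rank ≤ A.rank := by
  have := Matrix.rank_mul_le_right (Matrix.scalar (Fin M) t) A
  simpa [← Matrix.smul_eq_diagonal_mul] using this

theorem mem_coneIdeal_of_forall {M N : ℕ} {Z : Set (BiProj M N)} (hZ : Z ⊆ incidence M N)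
    {f : MvPolynomial (Coord M N) ℂ}
    (hf : ∀ (α : Fin N → Fin M → ℂ) (A : Matrix (Fin M) (Fin M) ℂ), A.IsSymm → A.rank ≤ 2 →
      SatisfiesDagger α A → eval (coords α A) f = 0) : f ∈ coneIdeal Z := by
  rw [mem_coneIdeal]
  intro p hp
  rw [restrictPlane_eq_zero_iff]
  intro s t
  obtain ⟨⟨h1, h2⟩, h3, h4, h5⟩ := hZ hp
  refine hf _ _ (h1.smul t) ((rank_smul_le _ _).trans h2) ⟨fun i hi => ?_, fun i hi => ?_,
    fun k l hk hk' hkl => ?_⟩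
  · rw [Pi.smul_apply, quad_smul_smul, h3 i hi, mul_zero]
  · rw [Pi.smul_apply, quad_smul_smul, h4 i hi, mul_zero]
  · rw [Pi.smul_apply, Pi.smul_apply, quad_smul_smul, quad_smul_smul, ← mul_add,
      h5 k l hk hk' hkl, mul_zero]

theorem det_submatrix_eq_zero_of_rank_le_two {M : ℕ} {A : Matrix (Fin M) (Fin M) ℂ}
    (hA : A.rank ≤ 2) (r c : Fin 3 → Fin M) : (A.submatrix r c).det = 0 := by
  by_contra h
  have h1 := Matrix.rank_of_isUnit (A.submatrix r c)
    ((Matrix.isUnit_iff_isUnit_det _).2 (isUnit_iff_ne_zero.2 h))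
  have h2 := Matrix.rank_submatrix_le A r c
  rw [Fintype.card_fin] at h1
  omega

/-- The algebraic count is applied to the generic point of the cone: the classes of the coordinates
in the fraction field satisfy every equation that holds on the affine cone. -/
theorem quotientTrdeg_coneIdeal_le {M N : ℕ} (hN : 2 ≤ N) (hNeven : Even N)
    {Z : Set (BiProj M N)} (hirr : IsIrreducible Z) (hZ : Z ⊆ incidence M N) :
    quotientTrdeg (coneIdeal Z) + (N / 2 + 2) ≤ 2 * M + M * N := by
  classical
  have hP := coneIdeal_isPrime hirr
  set P := coneIdeal Z
  let K := FractionRing (MvPolynomial (Coord M N) ℂ ⧸ P)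
  let θ : MvPolynomial (Coord M N) ℂ →ₐ[ℂ] K :=
    (IsScalarTower.toAlgHom ℂ (MvPolynomial (Coord M N) ℂ ⧸ P) K).comp (Ideal.Quotient.mkₐ ℂ P)
  have hθ : ∀ f, θ f = 0 ↔ f ∈ P := fun f => by
    rw [← Ideal.Quotient.eq_zero_iff_mem]
    exact map_eq_zero_iff _ (IsFractionRing.injective (MvPolynomial (Coord M N) ℂ ⧸ P) K)
  obtain ⟨p, hp⟩ := hirr.1
  have key := trdeg_le_of_symm_rank_two_of_quadSum (K := K) (M := M) (N := N) (by omega)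
    (fun a b => θ (X (Sum.inr (a, b)))) (fun i b => θ (X (Sum.inl (i, b)))) ?_ ?_ ?_ ?_ ?_
  · obtain ⟨n, hn, hn'⟩ := key
    have hle : Algebra.trdeg ℂ (MvPolynomial (Coord M N) ℂ ⧸ P) ≤ n :=
      (trdeg_le_of_injective (IsScalarTower.toAlgHom ℂ _ K)
        (IsFractionRing.injective (MvPolynomial (Coord M N) ℂ ⧸ P) K)).trans hn
    have : quotientTrdeg P ≤ n := by
      simpa [quotientTrdeg] using Cardinal.toNat_le_toNat hle Cardinal.natCast_lt_aleph0
    omega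
  · intro a b
    rw [← sub_eq_zero, ← map_sub, hθ]
    refine mem_coneIdeal_of_forall hZ fun α A h1 _ _ => ?_
    simp [coords, h1.apply a b]
  · intro r c
    have h : (Matrix.of fun i j => θ (X (Sum.inr (r i, c j)))) =
        θ.toRingHom.mapMatrix (Matrix.of fun i j => X (Sum.inr (r i, c j))) := by
      ext i j; rfl
    rw [h, ← RingHom.map_det]
    refine (hθ _).2 (mem_coneIdeal_of_forall hZ fun α A _ h2 _ => ?_)
    rw [RingHom.map_det]
    convert det_submatrix_eq_zero_of_rank_le_two h2 r c using 2
    ext i j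
    simp [coords]
  · by_contra! h
    apply p.mat.rep_nonzero
    ext a b
    have := (restrictPlane_eq_zero_iff _ _ _).1 (mem_coneIdeal.1 ((hθ _).1 (h a b)) p hp) 1 1
    simpa [coords] using this
  · have hmem : ∀ i : Fin N, quadSum (fun a b => θ (X (Sum.inr (a, b))))
        (fun b => θ (X (Sum.inl (i, b)))) =
        θ (quadSum (fun a b => X (Sum.inr (a, b))) (fun b => X (Sum.inl (i, b)))) :=
      fun i => (map_quadSum θ.toRingHom _ _).symm
    have heval : ∀ (α : Fin N → Fin M → ℂ) (A : Matrix (Fin M) (Fin M) ℂ) (i : Fin N),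
        eval (coords α A) (quadSum (fun a b => X (Sum.inr (a, b))) (fun b => X (Sum.inl (i, b)))) =
        quad A (α i) := fun α A i => by
      rw [map_quadSum, quad_eq_quadSum]
      simp [coords]
    intro i hi
    simp only [hmem]
    by_cases h0 : (i : ℕ) = 0
    · left
      refine (hθ _).2 (mem_coneIdeal_of_forall hZ fun α A _ _ h => ?_)
      rw [heval]
      exact h.1 i h0
    by_cases h1 : (i : ℕ) = N / 2
    · left
      refine (hθ _).2 (mem_coneIdeal_of_forall hZ fun α A _ _ h => ?_)
      rw [heval]
      exact h.2.1 i h1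
    right
    obtain ⟨k, rfl⟩ := hNeven
    refine ⟨⟨(k + k) - i, by omega⟩, by simp only; omega, ?_⟩
    rw [← map_add, hθ]
    refine mem_coneIdeal_of_forall hZ fun α A _ _ h => ?_
    rw [map_add, heval, heval]
    exact h.2.2 _ _ (by omega) (by omega) (by simp only; omega)
  · intro E hA hα
    have hmem : ∀ f, θ f ∈ E := fun f => by
      induction f using MvPolynomial.induction_on with
      | C a => exact (θ.commutes a).symm ▸ E.algebraMap_mem a
      | add p q hp hq => rw [map_add]; exact add_mem hp hq
      | mul_X p i hp =>
        rw [map_mul]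
        rcases i with ⟨i, b⟩ | ⟨a, b⟩
        · exact mul_mem hp (hα i b)
        · exact mul_mem hp (hA a b)
    rw [eq_top_iff]
    intro y _
    obtain ⟨u, v, -, rfl⟩ := IsFractionRing.div_surjective
      (A := MvPolynomial (Coord M N) ℂ ⧸ P) y
    obtain ⟨u, rfl⟩ := Ideal.Quotient.mk_surjective u
    obtain ⟨v, rfl⟩ := Ideal.Quotient.mk_surjective v
    exact div_mem (hmem u) (hmem v)

theorem length_le_of_ltSeries_incidence {M N : ℕ} (hN : 2 ≤ N) (hNeven : Even N)
    (l : LTSeries (TopologicalSpace.IrreducibleCloseds (incidence M N))) :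
    l.length + (N / 2 + 4) ≤ 2 * M + M * N := by
  let cl : TopologicalSpace.IrreducibleCloseds (incidence M N) → Set (BiProj M N) :=
    fun W => Subtype.val '' (W : Set (incidence M N))
  have hirr : ∀ W, IsIrreducible (cl W) := fun W =>
    W.isIrreducible.image _ continuous_subtype_val.continuousOn
  have hsub : ∀ W, cl W ⊆ incidence M N := fun W => by
    rintro _ ⟨x, _, rfl⟩
    exact x.2
  have hmono : StrictMono fun W => quotientTrdeg (coneIdeal (cl W)) := by
    intro V W hVW
    have := coneIdeal_isPrime (hirr V)
    have := coneIdeal_isPrime (hirr W)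
    -- Equal cone ideals would force equal sets: a bihomogeneous equation of `V` fails at some point
    -- of `W`. Only relative closedness in the incidence set is used.
    refine quotientTrdeg_lt (lt_of_le_of_ne (coneIdeal_anti (Set.image_mono hVW.le)) fun heq => ?_)
    obtain ⟨q, hqW, hqV⟩ := Set.exists_of_ssubset (SetLike.coe_ssubset_coe.2 hVW)
    obtain ⟨T, hT, hTV⟩ := isClosed_induced_iff.1 V.isClosed
    obtain ⟨S, hS, rfl⟩ := exists_zeroLocus_of_isClosed hT
    have hqT : (q : BiProj M N) ∉ zeroLocus S := fun h => hqV (by rw [← hTV]; exact h)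
    simp only [zeroLocus, Set.mem_ofPred_eq, not_forall] at hqT
    obtain ⟨f, hf, hfq⟩ := hqT
    obtain ⟨d, hd⟩ := hS f hf
    have hfV : f ∈ coneIdeal (cl V) := by
      rw [mem_coneIdeal]
      rintro _ ⟨x, hx, rfl⟩
      rw [restrictPlane_eq_zero_iff_of_isWeightedHomogeneous hd]
      rw [← hTV] at hx
      exact hx f hf
    rw [← heq] at hfV
    exact hfq ((restrictPlane_eq_zero_iff_of_isWeightedHomogeneous hd).1
      (mem_coneIdeal.1 hfV q ⟨q, hqW, rfl⟩))
  have h1 := LTSeries.head_add_length_le_nat (l.map _ hmono)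
  have h2 := two_le_quotientTrdeg_coneIdeal (hirr l.head)
  have h3 := quotientTrdeg_coneIdeal_le hN hNeven (hirr l.last) (hsub l.last)
  simp only [LTSeries.head_map, LTSeries.last_map, LTSeries.map_length] at h1
  omega

/-! ### Chains from polynomial parametrizations -/

/-- Functions on affine space given by polynomials. -/
def IsPolyFun {ι : Type} (g : (ι → ℂ) → ℂ) : Prop :=
  ∃ P : MvPolynomial ι ℂ, ∀ t, g t = eval t P

namespace IsPolyFun

variable {ι : Type} {g h : (ι → ℂ) → ℂ}

theorem const (c : ℂ) : IsPolyFun (fun _ : ι → ℂ => c) := ⟨C c, fun t => by simp⟩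

theorem var (i : ι) : IsPolyFun (fun t : ι → ℂ => t i) := ⟨X i, fun t => by simp⟩

theorem add (hg : IsPolyFun g) (hh : IsPolyFun h) : IsPolyFun fun t => g t + h t := by
  obtain ⟨P, hP⟩ := hg
  obtain ⟨Q, hQ⟩ := hh
  exact ⟨P + Q, fun t => by simp [hP, hQ]⟩

theorem mul (hg : IsPolyFun g) (hh : IsPolyFun h) : IsPolyFun fun t => g t * h t := by
  obtain ⟨P, hP⟩ := hg
  obtain ⟨Q, hQ⟩ := hh
  exact ⟨P * Q, fun t => by simp [hP, hQ]⟩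

theorem neg (hg : IsPolyFun g) : IsPolyFun fun t => -g t := by
  obtain ⟨P, hP⟩ := hg
  exact ⟨-P, fun t => by simp [hP]⟩

theorem sub (hg : IsPolyFun g) (hh : IsPolyFun h) : IsPolyFun fun t => g t - h t := by
  simpa only [sub_eq_add_neg] using hg.add hh.neg

theorem sum {κ : Type} [Fintype κ] {g : κ → (ι → ℂ) → ℂ} (hg : ∀ k, IsPolyFun (g k)) :
    IsPolyFun fun t => ∑ k, g k t := by
  choose P hP using hg
  exact ⟨∑ k, P k, fun t => by simp [hP]⟩

theorem eval_comp {σ : Type} {φ : (ι → ℂ) → σ → ℂ} (hφ : ∀ c, IsPolyFun fun t => φ t c)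
    (f : MvPolynomial σ ℂ) : IsPolyFun fun t => eval (φ t) f := by
  choose P hP using hφ
  refine ⟨bind₁ P f, fun t => ?_⟩
  induction f using MvPolynomial.induction_on with
  | C a => simp
  | add p q hp hq => simp only [map_add, hp, hq]
  | mul_X p i hp => simp only [map_mul, hp, eval_X, bind₁_X_right, ← hP]

theorem comp (hg : IsPolyFun g) {ρ : (ι → ℂ) → ι → ℂ} (hρ : ∀ c, IsPolyFun fun t => ρ t c) :
    IsPolyFun fun t => g (ρ t) := by
  obtain ⟨P, hP⟩ := hg
  simpa only [hP] using eval_comp hρ P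

theorem eq_zero_or_eq_zero (hg : IsPolyFun g) (hh : IsPolyFun h) (hgh : ∀ t, g t * h t = 0) :
    (∀ t, g t = 0) ∨ ∀ t, h t = 0 := by
  obtain ⟨P, hP⟩ := hg
  obtain ⟨Q, hQ⟩ := hh
  have : P * Q = 0 := MvPolynomial.funext fun t => by simp [← hP, ← hQ, hgh]
  rcases mul_eq_zero.1 this with h0 | h0
  · left; intro t; rw [hP, h0, map_zero]
  · right; intro t; rw [hQ, h0, map_zero]

end IsPolyFun

/-- Bihomogeneous equations pull back to polynomials on affine space, whose coordinate ring is a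
domain. -/
theorem isIrreducible_range_of_isPolyFun {M N : ℕ} {ι : Type} {α : (ι → ℂ) → Fin N → Fin M → ℂ}
    {A : (ι → ℂ) → Matrix (Fin M) (Fin M) ℂ} (hpoly : ∀ c, IsPolyFun fun t => coords (α t) (A t) c)
    (hα : ∀ t, α t ≠ 0) (hA : ∀ t, A t ≠ 0) (x : (ι → ℂ) → incidence M N)
    (hx : ∀ t, (x t : BiProj M N) =
      ⟨Projectivization.mk ℂ (α t) (hα t), Projectivization.mk ℂ (A t) (hA t)⟩) :
    IsIrreducible (Set.range x) := by
  refine ⟨Set.range_nonempty x, isPreirreducible_iff_isClosed_union_isClosed.2 ?_⟩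
  intro Z₁ Z₂ h₁ h₂ hsub
  obtain ⟨T₁, hT₁, rfl⟩ := isClosed_induced_iff.1 h₁
  obtain ⟨T₂, hT₂, rfl⟩ := isClosed_induced_iff.1 h₂
  obtain ⟨S₁, hS₁, rfl⟩ := exists_zeroLocus_of_isClosed hT₁
  obtain ⟨S₂, hS₂, rfl⟩ := exists_zeroLocus_of_isClosed hT₂
  have hiff : ∀ f, IsBihomogeneous f → ∀ t, (VanishesAt f (x t) ↔ eval (coords (α t) (A t)) f = 0) :=
    fun f hf t => by rw [hx t]; exact vanishesAt_mk hf (hα t) (hA t)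
  by_contra! hcon
  obtain ⟨h1, h2⟩ := hcon
  obtain ⟨_, ⟨t₁, rfl⟩, ht₁⟩ := Set.not_subset.1 h1
  obtain ⟨_, ⟨t₂, rfl⟩, ht₂⟩ := Set.not_subset.1 h2
  simp only [Set.mem_preimage, zeroLocus, Set.mem_ofPred_eq, not_forall] at ht₁ ht₂
  obtain ⟨f, hf, hft⟩ := ht₁
  obtain ⟨g, hg, hgt⟩ := ht₂
  rw [hiff f (hS₁ f hf)] at hft
  rw [hiff g (hS₂ g hg)] at hgt
  rcases (IsPolyFun.eval_comp hpoly f).eq_zero_or_eq_zero (IsPolyFun.eval_comp hpoly g) (fun t => by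
    rcases hsub ⟨t, rfl⟩ with h | h
    · rw [(hiff f (hS₁ f hf) t).1 (h f hf), zero_mul]
    · rw [(hiff g (hS₂ g hg) t).1 (h g hg), mul_zero]) with h | h
  · exact hft (h t₁)
  · exact hgt (h t₂)

theorem exists_equiv_monotone {κ : Type} [Fintype κ] (lev : κ → ℕ) :
    ∃ e : Fin (Fintype.card κ) ≃ κ, Monotone (lev ∘ e) :=
  ⟨(Tuple.sort (lev ∘ (Fintype.equivFin κ).symm)).trans (Fintype.equivFin κ).symm,
    Tuple.monotone_sort (lev ∘ (Fintype.equivFin κ).symm)⟩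

theorem le_topologicalKrullDim_incidence_of_parametrization {M N : ℕ} {ι : Type} [Fintype ι]
    [DecidableEq ι] (i₀ : ι) (lev : ι → ℕ) (α : (ι → ℂ) → Fin N → Fin M → ℂ)
    (A : (ι → ℂ) → Matrix (Fin M) (Fin M) ℂ) (hpoly : ∀ c, IsPolyFun fun t => coords (α t) (A t) c)
    (hα : ∀ t, t i₀ = 1 → α t ≠ 0) (hA : ∀ t, A t ≠ 0)
    (hmem : ∀ t, ((A t).IsSymm ∧ (A t).rank ≤ 2) ∧ SatisfiesDagger (α t) (A t))
    (f : ι → MvPolynomial (Coord M N) ℂ) (hf : ∀ i, IsBihomogeneous (f i))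
    (hf0 : ∀ i t, t i = 0 → eval (coords (α t) (A t)) (f i) = 0)
    (hf1 : ∀ i, i ≠ i₀ → ∃ t : ι → ℂ, t i₀ = 1 ∧
      (∀ j, t j ≠ 0 → j = i ∨ j = i₀ ∨ lev j < lev i) ∧ eval (coords (α t) (A t)) (f i) ≠ 0) :
    ((Fintype.card ι - 1 : ℕ) : WithBot ℕ∞) ≤ topologicalKrullDim (incidence M N) := by
  obtain ⟨e, he⟩ := exists_equiv_monotone (fun i : {i // i ≠ i₀} => lev i)
  have hcard : Fintype.card {i // i ≠ i₀} = Fintype.card ι - 1 := by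
    simp
  rw [← hcard]
  -- The k-th stage leaves free the first k parameters in order of level, sets the others to 0 and
  -- `i₀` to 1.
  let ρ : ℕ → (ι → ℂ) → ι → ℂ := fun k t j =>
    if hj : j = i₀ then 1 else if k ≤ (e.symm ⟨j, hj⟩ : ℕ) then 0 else t j
  have hρ0 : ∀ k t, ρ k t i₀ = 1 := fun k t => by simp [ρ]
  have hρpoly : ∀ k c, IsPolyFun fun t => ρ k t c := by
    intro k c
    simp only [ρ]
    split_ifs
    · exact IsPolyFun.const 1
    · exact IsPolyFun.const 0
    · exact IsPolyFun.var c
  let x : ℕ → (ι → ℂ) → incidence M N := fun k t =>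
    ⟨⟨Projectivization.mk ℂ (α (ρ k t)) (hα _ (hρ0 k t)), Projectivization.mk ℂ (A (ρ k t)) (hA _)⟩,
      (mk_mem_incidence _ _).2 (hmem _)⟩
  have hirr : ∀ k, IsIrreducible (Set.range (x k)) := fun k =>
    isIrreducible_range_of_isPolyFun (α := fun t => α (ρ k t)) (A := fun t => A (ρ k t))
      (fun c => (hpoly c).comp (hρpoly k)) _ _ (x k) fun t => rfl
  let Z : ℕ → TopologicalSpace.IrreducibleCloseds (incidence M N) := fun k =>
    ⟨closure (Set.range (x k)), (hirr k).closure, isClosed_closure⟩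
  have hx : ∀ k t t', ρ k t = t' → t' i₀ = 1 → ∀ i, VanishesAt (f i) (x k t) ↔
      eval (coords (α t') (A t')) (f i) = 0 := by
    rintro k t _ rfl _ i
    exact vanishesAt_mk (hf i) _ _
  have hle : ∀ k, Z k ≤ Z (k + 1) := by
    intro k
    refine closure_mono ?_
    rintro _ ⟨t, rfl⟩
    refine ⟨ρ k t, ?_⟩
    have : ρ (k + 1) (ρ k t) = ρ k t := by
      ext j
      simp only [ρ]
      split_ifs <;> first | rfl | omega
    simp only [x, this]
  have hlt : ∀ k : Fin (Fintype.card {i // i ≠ i₀}), Z k < Z (k + 1) := by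
    intro k
    refine lt_of_le_of_ne (hle k) fun heq => ?_
    obtain ⟨t, ht0, htsupp, htne⟩ := hf1 (e k) (e k).2
    -- The witness involves only the new parameter, `i₀` and lower levels, all of which are already
    -- free because `e` sorts by level.
    have hρt : ρ (k + 1) t = t := by
      ext j
      simp only [ρ]
      split_ifs with h1 h2
      · rw [h1, ht0]
      · by_contra hne
        rcases htsupp j (Ne.symm hne) with h | h | h
        · have : e.symm ⟨j, h1⟩ = k := by
            rw [Equiv.symm_apply_eq]; exact Subtype.ext h
          rw [this] at h2
          omega
        · exact h1 h
        · have h3 : k ≤ e.symm ⟨j, h1⟩ := Fin.le_def.2 (by omega)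
          have h4 := he h3
          simp only [Function.comp_apply, Equiv.apply_symm_apply] at h4
          omega
      · rfl
    have hsub : (Z k : Set (incidence M N)) ⊆ Subtype.val ⁻¹' zeroLocus {f (e k)} := by
      refine closure_minimal ?_ ((isClosed_zeroLocus ?_).preimage continuous_subtype_val)
      · rintro _ ⟨s, rfl⟩ _ rfl
        refine (hx k s _ rfl (hρ0 k s) _).2 (hf0 _ _ ?_)
        have := (e k).2
        simp only [ρ]
        rw [dif_neg this, if_pos (by simp)]
      · rintro _ rfl
        exact hf _
    have hmemZ : x (k + 1) t ∈ Z k := by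
      rw [heq]
      exact subset_closure ⟨t, rfl⟩
    exact htne ((hx (k + 1) t t hρt ht0 _).1 (hsub hmemZ _ rfl))
  have hmono : StrictMono fun k : Fin (Fintype.card {i // i ≠ i₀} + 1) => Z k := by
    rw [Fin.strictMono_iff_lt_succ]
    intro k
    simpa using hlt k
  exact Order.LTSeries.length_le_krullDim (LTSeries.mk _ _ hmono)

/-! ### A parametrized family in the incidence variety -/

/-- The parameters: two vectors for the matrix, one for each of the two isotropic vectors of the
frame, and two for each of the `K` pairs of vectors of the frame. -/
abbrev ParamIndex (m K : ℕ) : Type :=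
  ((Fin m ⊕ Fin m) ⊕ (Fin m ⊕ Fin m)) ⊕ ((Fin K × Fin (m + 1)) ⊕ (Fin K × Fin m))

namespace ParamIndex

variable {m K : ℕ}

abbrev p (j : Fin m) : ParamIndex m K := .inl (.inl (.inl j))
abbrev s (j : Fin m) : ParamIndex m K := .inl (.inl (.inr j))
abbrev x (j : Fin m) : ParamIndex m K := .inl (.inr (.inl j))
abbrev y (j : Fin m) : ParamIndex m K := .inl (.inr (.inr j))
abbrev z (k : Fin K) (a : Fin (m + 1)) : ParamIndex m K := .inr (.inl (k, a))
abbrev r (k : Fin K) (j : Fin m) : ParamIndex m K := .inr (.inr (k, j))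

/-- The parameters `r` come last. -/
def level : ParamIndex m K → ℕ := Sum.elim (fun _ => 0) (Sum.elim (fun _ => 0) (fun _ => 1))

end ParamIndex

section Family

variable {m K : ℕ} (t : ParamIndex m K → ℂ)

/-- The first of the two linear factors of the quadratic form. -/
def factorLeft : Fin (m + 1) → ℂ := Fin.cons 1 fun j => t (.p j)

/-- The second of the two linear factors of the quadratic form. -/
def factorRight : Fin (m + 1) → ℂ := Fin.cons 1 fun j => t (.s j) - t (.p j)

/-- The symmetric matrix of the product of two linear forms. -/
def familyMatrix : Matrix (Fin (m + 1)) (Fin (m + 1)) ℂ :=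
  Matrix.vecMulVec (factorLeft t) (factorRight t) + Matrix.vecMulVec (factorRight t) (factorLeft t)

/-- The vector with last coordinates `v` in the kernel of the first linear factor. -/
def isotropic (v : Fin m → ℂ) : Fin (m + 1) → ℂ := Fin.cons (-∑ j, t (.p j) * v j) v

/-- The vector `z` of the `k`-th pair. -/
def pairZ (k : Fin K) : Fin (m + 1) → ℂ := fun a => t (.z k a)

/-- The image of `z` under the matrix. -/
def pairAZ (k : Fin K) : Fin (m + 1) → ℂ := fun a => ∑ b, familyMatrix t a b * pairZ t k b

/-- A vector orthogonal to `z`. -/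
def pairW (k : Fin K) : Fin (m + 1) → ℂ :=
  Fin.cons (-∑ j : Fin m, pairAZ t k j.succ * t (.r k j)) fun j => pairAZ t k 0 * t (.r k j)

/-- The frame of the family. -/
noncomputable def familyFrame (i : Fin (2 * K + 2)) : Fin (m + 1) → ℂ :=
  if (i : ℕ) = 0 then isotropic t fun j => t (.x j)
  else if (i : ℕ) = K + 1 then isotropic t fun j => t (.y j)
  else if h : (i : ℕ) - 1 < K then
    fun a => 2⁻¹ * (pairW t ⟨i - 1, h⟩ a + pairZ t ⟨i - 1, h⟩ a)
  else if h : 2 * K + 1 - (i : ℕ) < K then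
    fun a => Complex.I * 2⁻¹ * (pairZ t ⟨2 * K + 1 - i, h⟩ a - pairW t ⟨2 * K + 1 - i, h⟩ a)
  else 0

theorem familyMatrix_apply (a b : Fin (m + 1)) : familyMatrix t a b =
    factorLeft t a * factorRight t b + factorRight t a * factorLeft t b := by
  simp [familyMatrix, Matrix.vecMulVec_apply]

theorem familyMatrix_zero_zero : familyMatrix t 0 0 = 2 := by
  simp [familyMatrix_apply, factorLeft, factorRight]; norm_num

/-- This is why the second factor is written with `s - p`: the first row reads off `s` alone. -/
theorem familyMatrix_zero_succ (j : Fin m) : familyMatrix t 0 j.succ = t (.s j) := by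
  simp [familyMatrix_apply, factorLeft, factorRight]

theorem familyMatrix_succ_succ (j : Fin m) :
    familyMatrix t j.succ j.succ = 2 * t (.p j) * (t (.s j) - t (.p j)) := by
  simp [familyMatrix_apply, factorLeft, factorRight]; ring

theorem familyMatrix_isSymm : (familyMatrix t).IsSymm := by
  ext a b
  simp [Matrix.transpose_apply, familyMatrix_apply]; ring

theorem familyMatrix_rank_le : (familyMatrix t).rank ≤ 2 := by
  have h : familyMatrix t = (Matrix.of fun a => ![factorLeft t a, factorRight t a]) *
      Matrix.of ![factorRight t, factorLeft t] := by
    ext a b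
    simp [familyMatrix_apply, Matrix.mul_apply, Fin.sum_univ_two]
  rw [h]
  exact (Matrix.rank_mul_le_left _ _).trans (Matrix.rank_le_width _)

theorem familyMatrix_ne_zero : familyMatrix t ≠ 0 := fun h => by
  have := familyMatrix_zero_zero t
  rw [h] at this
  simp at this

theorem quad_isotropic (v : Fin m → ℂ) : quad (familyMatrix t) (isotropic t v) = 0 := by
  have h : factorLeft t ⬝ᵥ isotropic t v = 0 := by
    simp [dotProduct, Fin.sum_univ_succ, factorLeft, isotropic]
  have h' : isotropic t v ⬝ᵥ factorLeft t = 0 := by rw [dotProduct_comm, h]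
  simp [quad, familyMatrix, Matrix.add_mulVec, Matrix.vecMulVec_mulVec, h, h']

theorem sum_pairW_mul_pairAZ (k : Fin K) : ∑ a, pairW t k a * pairAZ t k a = 0 := by
  simp only [Fin.sum_univ_succ, pairW, Fin.cons_zero, Fin.cons_succ, neg_mul, Finset.sum_mul]
  rw [neg_add_eq_zero]
  exact Finset.sum_congr rfl fun j _ => by ring

/-- By polarization, ¼(Q(w + z) - Q(z - w)) = wᵀAz, which vanishes by the choice of `pairW`. -/
theorem quad_pair_add (k : Fin K) :
    quad (familyMatrix t) (fun a => 2⁻¹ * (pairW t k a + pairZ t k a)) +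
      quad (familyMatrix t) (fun a => Complex.I * 2⁻¹ * (pairZ t k a - pairW t k a)) = 0 := by
  have h1 := sum_pairW_mul_pairAZ t k
  simp only [pairAZ, Finset.mul_sum] at h1
  have h2 : ∑ a, ∑ b, pairZ t k a * (familyMatrix t a b * pairW t k b) = 0 := by
    rw [Finset.sum_comm, ← h1]
    refine Finset.sum_congr rfl fun a _ => Finset.sum_congr rfl fun b _ => ?_
    rw [← (familyMatrix_isSymm t).apply a b]
    ring
  rw [quad_eq_quadSum, quad_eq_quadSum]
  simp only [quadSum]
  rw [← Finset.sum_add_distrib]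
  have h3 : (2⁻¹ : ℂ) * (0 + 0) = 0 := by simp
  rw [← h3]
  nth_rw 1 [← h1]
  rw [← h2, ← Finset.sum_add_distrib, Finset.mul_sum]
  refine Finset.sum_congr rfl fun a _ => ?_
  rw [← Finset.sum_add_distrib, ← Finset.sum_add_distrib, Finset.mul_sum]
  refine Finset.sum_congr rfl fun b _ => ?_
  linear_combination (familyMatrix t a b * (2⁻¹ * (pairZ t k a - pairW t k a)) *
    (2⁻¹ * (pairZ t k b - pairW t k b))) * Complex.I_mul_I

theorem familyFrame_zero (i : Fin (2 * K + 2)) (hi : (i : ℕ) = 0) :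
    familyFrame t i = isotropic t fun j => t (.x j) := by
  simp [familyFrame, hi]

theorem familyFrame_mid (i : Fin (2 * K + 2)) (hi : (i : ℕ) = K + 1) :
    familyFrame t i = isotropic t fun j => t (.y j) := by
  simp [familyFrame, hi]

theorem familyFrame_left (i : Fin (2 * K + 2)) (k : Fin K) (hi : (i : ℕ) = k + 1) :
    familyFrame t i = fun a => 2⁻¹ * (pairW t k a + pairZ t k a) := by
  have hk := k.2
  have h1 : (⟨i - 1, by omega⟩ : Fin K) = k := Fin.ext (by simp only; omega)
  rw [familyFrame, if_neg (by omega), if_neg (by omega), dif_pos (by omega), h1]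

theorem familyFrame_right (i : Fin (2 * K + 2)) (k : Fin K) (hi : (i : ℕ) = 2 * K + 1 - k) :
    familyFrame t i = fun a => Complex.I * 2⁻¹ * (pairZ t k a - pairW t k a) := by
  have hk := k.2
  have h1 : (⟨2 * K + 1 - i, by omega⟩ : Fin K) = k := Fin.ext (by simp only; omega)
  rw [familyFrame, if_neg (by omega), if_neg (by omega), dif_neg (by omega), dif_pos (by omega), h1]

theorem satisfiesDagger_family : SatisfiesDagger (familyFrame t) (familyMatrix t) := by
  refine ⟨fun i hi => ?_, fun i hi => ?_, fun k l hk hk' hkl => ?_⟩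
  · rw [familyFrame_zero t i hi, quad_isotropic]
  · rw [familyFrame_mid t i (by omega), quad_isotropic]
  · rw [familyFrame_left t k ⟨k - 1, by omega⟩ (by simp only; omega),
      familyFrame_right t l ⟨k - 1, by omega⟩ (by simp only; omega), quad_pair_add]

end Family

/-! ### Polynomiality of the family and polynomials detecting its parameters -/

section Polynomial

variable {m K : ℕ}

theorem isPolyFun_factorLeft (a : Fin (m + 1)) :
    IsPolyFun fun t : ParamIndex m K → ℂ => factorLeft t a := by
  induction a using Fin.cases with
  | zero => simpa [factorLeft] using IsPolyFun.const 1
  | succ j => simpa [factorLeft] using IsPolyFun.var _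

theorem isPolyFun_factorRight (a : Fin (m + 1)) :
    IsPolyFun fun t : ParamIndex m K → ℂ => factorRight t a := by
  induction a using Fin.cases with
  | zero => simpa [factorRight] using IsPolyFun.const 1
  | succ j => simpa [factorRight] using (IsPolyFun.var _).sub (IsPolyFun.var _)

theorem isPolyFun_familyMatrix (a b : Fin (m + 1)) :
    IsPolyFun fun t : ParamIndex m K → ℂ => familyMatrix t a b := by
  simp only [familyMatrix_apply]
  exact ((isPolyFun_factorLeft a).mul (isPolyFun_factorRight b)).add
    ((isPolyFun_factorRight a).mul (isPolyFun_factorLeft b))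

theorem isPolyFun_isotropic (v : Fin m → ParamIndex m K) (a : Fin (m + 1)) :
    IsPolyFun fun t : ParamIndex m K → ℂ => isotropic t (fun j => t (v j)) a := by
  induction a using Fin.cases with
  | zero =>
    simp only [isotropic, Fin.cons_zero]
    exact (IsPolyFun.sum fun j => (IsPolyFun.var _).mul (IsPolyFun.var _)).neg
  | succ j => simpa [isotropic] using IsPolyFun.var _

theorem isPolyFun_pairZ (k : Fin K) (a : Fin (m + 1)) :
    IsPolyFun fun t : ParamIndex m K → ℂ => pairZ t k a :=
  IsPolyFun.var (ParamIndex.z k a)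

theorem isPolyFun_pairAZ (k : Fin K) (a : Fin (m + 1)) :
    IsPolyFun fun t : ParamIndex m K → ℂ => pairAZ t k a := by
  simp only [pairAZ]
  exact IsPolyFun.sum fun b => (isPolyFun_familyMatrix a b).mul (isPolyFun_pairZ k b)

theorem isPolyFun_pairW (k : Fin K) (a : Fin (m + 1)) :
    IsPolyFun fun t : ParamIndex m K → ℂ => pairW t k a := by
  induction a using Fin.cases with
  | zero =>
    simp only [pairW, Fin.cons_zero]
    refine IsPolyFun.neg (IsPolyFun.sum fun j => IsPolyFun.mul ?_ ?_)
    · exact isPolyFun_pairAZ k j.succ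
    · exact IsPolyFun.var _
  | succ j =>
    simp only [pairW, Fin.cons_succ]
    exact IsPolyFun.mul (isPolyFun_pairAZ k 0) (IsPolyFun.var _)

theorem isPolyFun_coords_family (c : Coord (m + 1) (2 * K + 2)) :
    IsPolyFun fun t : ParamIndex m K → ℂ => coords (familyFrame t) (familyMatrix t) c := by
  rcases c with ⟨i, a⟩ | ⟨a, b⟩
  · simp only [coords, Sum.elim_inl, familyFrame]
    split_ifs
    · exact isPolyFun_isotropic _ a
    · exact isPolyFun_isotropic _ a
    · exact (IsPolyFun.const _).mul ((isPolyFun_pairW _ a).add (isPolyFun_pairZ _ a))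
    · exact (IsPolyFun.const _).mul ((isPolyFun_pairZ _ a).sub (isPolyFun_pairW _ a))
    · exact IsPolyFun.const 0
  · exact isPolyFun_familyMatrix a b

/-- A bihomogeneous polynomial that detects the vanishing of a parameter. -/
noncomputable def detector : ParamIndex m K → MvPolynomial (Coord (m + 1) (2 * K + 2)) ℂ
  | .inl (.inl (.inl j)) => X (.inr (j.succ, j.succ))
  | .inl (.inl (.inr j)) => X (.inr (0, j.succ))
  | .inl (.inr (.inl j)) => X (.inl (0, j.succ))
  | .inl (.inr (.inr j)) => X (.inl (⟨K + 1, by omega⟩, j.succ))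
  | .inr (.inl (k, a)) => X (.inl (⟨k + 1, by omega⟩, a)) -
      C Complex.I * X (.inl (⟨2 * K + 1 - k, by omega⟩, a))
  | .inr (.inr (k, j)) => X (.inl (⟨k + 1, by omega⟩, j.succ)) +
      C Complex.I * X (.inl (⟨2 * K + 1 - k, by omega⟩, j.succ))

theorem isBihomogeneous_detector (i : ParamIndex m K) : IsBihomogeneous (detector i) := by
  have hX := fun c => isWeightedHomogeneous_X ℂ (biweight (m + 1) (2 * K + 2)) c
  rcases i with ((j | j) | (j | j)) | (⟨k, a⟩ | ⟨k, j⟩)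
  · exact ⟨_, hX _⟩
  · exact ⟨_, hX _⟩
  · exact ⟨_, hX _⟩
  · exact ⟨_, hX _⟩
  · exact ⟨(1, 0), (hX _).sub ((hX _).C_mul _)⟩
  · exact ⟨(1, 0), (hX _).add ((hX _).C_mul _)⟩

variable (t : ParamIndex m K → ℂ)

theorem eval_detector_p (j : Fin m) : eval (coords (familyFrame t) (familyMatrix t))
    (detector (.p j)) = 2 * t (.p j) * (t (.s j) - t (.p j)) := by
  simp [detector, coords, familyMatrix_succ_succ]

theorem eval_detector_s (j : Fin m) : eval (coords (familyFrame t) (familyMatrix t))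
    (detector (.s j)) = t (.s j) := by
  simp [detector, coords, familyMatrix_zero_succ]

theorem eval_detector_x (j : Fin m) : eval (coords (familyFrame t) (familyMatrix t))
    (detector (.x j)) = t (.x j) := by
  simp only [detector, coords, eval_X, Sum.elim_inl]
  rw [familyFrame_zero t 0 rfl]
  simp [isotropic]

theorem eval_detector_y (j : Fin m) : eval (coords (familyFrame t) (familyMatrix t))
    (detector (.y j)) = t (.y j) := by
  simp [detector, coords, familyFrame_mid, isotropic]

theorem eval_detector_z (k : Fin K) (a : Fin (m + 1)) :
    eval (coords (familyFrame t) (familyMatrix t)) (detector (.z k a)) = t (.z k a) := by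
  simp only [detector, coords, map_sub, map_mul, eval_X, eval_C, Sum.elim_inl]
  rw [familyFrame_left t _ k rfl, familyFrame_right t _ k rfl]
  simp only [pairZ]
  linear_combination (-(2⁻¹ * (t (.z k a) - pairW t k a))) * Complex.I_mul_I

/-- The factor `pairAZ t k 0` is the reason for the levels: `z` must be free before `r` can be
detected. -/
theorem eval_detector_r (k : Fin K) (j : Fin m) :
    eval (coords (familyFrame t) (familyMatrix t)) (detector (.r k j)) =
      pairAZ t k 0 * t (.r k j) := by
  simp only [detector, coords, map_add, map_mul, eval_X, eval_C, Sum.elim_inl]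
  rw [familyFrame_left t _ k rfl, familyFrame_right t _ k rfl]
  have : pairW t k j.succ = pairAZ t k 0 * t (.r k j) := by simp [pairW]
  rw [← this]
  linear_combination (2⁻¹ * (pairZ t k j.succ - pairW t k j.succ)) * Complex.I_mul_I

theorem pairAZ_zero (k : Fin K) :
    pairAZ t k 0 = 2 * t (.z k 0) + ∑ j : Fin m, t (.s j) * t (.z k j.succ) := by
  simp [pairAZ, Fin.sum_univ_succ, familyMatrix_zero_zero, familyMatrix_zero_succ, pairZ]

end Polynomial

theorem card_paramIndex_sub_one_le_topologicalKrullDim {m K : ℕ} (h : 1 ≤ m ∨ 1 ≤ K) :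
    ((4 * m + 2 * K * m + K - 1 : ℕ) : WithBot ℕ∞) ≤
      topologicalKrullDim (incidence (m + 1) (2 * K + 2)) := by
  obtain ⟨i₀, hi₀⟩ : ∃ i₀ : ParamIndex m K, (∃ j, i₀ = .x j) ∨ ∃ k a, i₀ = .z k a := by
    rcases h with h | h
    · exact ⟨.x ⟨0, h⟩, Or.inl ⟨_, rfl⟩⟩
    · exact ⟨.z ⟨0, h⟩ 0, Or.inr ⟨_, _, rfl⟩⟩
  have hcard : Fintype.card (ParamIndex m K) - 1 = 4 * m + 2 * K * m + K - 1 := by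
    simp only [Fintype.card_sum, Fintype.card_prod, Fintype.card_fin]
    congr 1
    ring
  rw [← hcard]
  refine le_topologicalKrullDim_incidence_of_parametrization i₀ ParamIndex.level familyFrame
    familyMatrix isPolyFun_coords_family (fun t ht h0 => ?_) familyMatrix_ne_zero
    (fun t => ⟨⟨familyMatrix_isSymm t, familyMatrix_rank_le t⟩, satisfiesDagger_family t⟩)
    detector isBihomogeneous_detector (fun i t hi => ?_) (fun i hi => ?_)
  · rcases hi₀ with ⟨j, rfl⟩ | ⟨k, a, rfl⟩
    · have := eval_detector_x t j
      rw [ht, h0] at this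
      simp [detector, coords] at this
    · have := eval_detector_z t k a
      rw [ht, h0] at this
      simp [detector, coords] at this
  · rcases i with ((j | j) | (j | j)) | (⟨k, a⟩ | ⟨k, j⟩)
    · rw [eval_detector_p, hi]; ring
    · rw [eval_detector_s, hi]
    · rw [eval_detector_x, hi]
    · rw [eval_detector_y, hi]
    · rw [eval_detector_z, hi]
    · rw [eval_detector_r, hi, mul_zero]
  · classical
    refine ⟨fun j => if j = i ∨ j = i₀ ∨ j.level < i.level then 1 else 0, by simp, fun j hj => ?_, ?_⟩
    · by_contra hcon
      exact hj (if_neg hcon)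
    · have hs : ∀ j, i₀ ≠ .s j := by
        rintro j rfl
        simp at hi₀
      rcases i with ((j | j) | (j | j)) | (⟨k, a⟩ | ⟨k, j⟩)
      · rw [eval_detector_p]
        simp [(hs j).symm, ParamIndex.level]
      · rw [eval_detector_s]
        simp
      · rw [eval_detector_x]
        simp
      · rw [eval_detector_y]
        simp
      · rw [eval_detector_z]
        simp
      · rw [eval_detector_r, pairAZ_zero]
        simp only [ParamIndex.level, Sum.elim_inl, Sum.elim_inr, zero_lt_one, or_true, true_or,
          if_true, mul_one, Finset.sum_const, Finset.card_univ, Fintype.card_fin, nsmul_eq_mul]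
        -- With all lower parameters equal to 1, the first entry of Az is 2 + m.
        exact_mod_cast (by omega : 2 + m ≠ 0)

end RealFrame

theorem mainTheorem9 (M N : ℕ) (hM : 1 ≤ M) (hN : 2 ≤ N) (hNeven : Even N)
    (hMN : ¬ (M = 1 ∧ N = 2)) :
    ∃ d : ℕ, topologicalKrullDim (RealFrame.incidence M N) = d ∧
      (d : ℚ) = 2 * M + M * N - N / 2 - 4 := by
  obtain ⟨m, rfl⟩ : ∃ m, M = m + 1 := ⟨M - 1, by omega⟩
  obtain ⟨K, rfl⟩ : ∃ K, N = 2 * K + 2 := by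
    obtain ⟨k, rfl⟩ := hNeven
    exact ⟨k - 1, by omega⟩
  have hmK : 1 ≤ m ∨ 1 ≤ K := by omega
  -- This makes the truncated subtraction exact; in the excluded case m = K = 0 the formula would
  -- give -1.
  have hpos : 1 ≤ 4 * m + 2 * K * m + K := by omega
  refine ⟨4 * m + 2 * K * m + K - 1, le_antisymm ?_ ?_, ?_⟩
  · refine iSup_le fun l => ?_
    have h := RealFrame.length_le_of_ltSeries_incidence hN hNeven l
    have h2 : (2 * K + 2) / 2 = K + 1 := by omega
    have h3 : (m + 1) * (2 * K + 2) = 2 * K * m + 2 * m + 2 * K + 2 := by ring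
    rw [h2, h3] at h
    exact_mod_cast (by omega : l.length ≤ 4 * m + 2 * K * m + K - 1)
  · exact RealFrame.card_paramIndex_sub_one_le_topologicalKrullDim hmK
  · rw [Nat.cast_sub hpos]
    push_cast
    ring
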